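/- Throughout, $\|\cdot\|$ is the Euclidean norm on $\mathbb{C}^n$, $q\ge 0$ is an integer, and a compact ball is a closed ball $\overline{B}$ of positive radius, with boundary sphere $bB$. Definitions. Let $u:U\to[-\infty,\infty)$ be upper semicontinuous on an open set $U\subset\mathbb{C}^n$. * $u$ is subpluriharmonic on $U$ if either $u\equiv-\infty$ on $U$, or for every compact ball $\overline{B}\subset U$ and every continuous (real-valued) plurisubharmonic function $h$ defined on a neighbourhood of $\overline{B}$, the maximum of $u+h$ over $\overline{B}$ is attained at a point of $bB$. * For $0\le q<n$, $u$ is $q$-plurisubharmonic on $U$ if it is subpluriharmonic on $U\cap\pi$ for every complex affine subspace $\pi\subset\mathbb{C}^n$ of dimension $q+1$. For $q\ge n$, every upper semicontinuous $u:U\to[-\infty,\infty)$ is $q$-plurisubharmonic by convention. * $u$ is strictly $q$-plurisubharmonic on $U$ if for every $y\in U$ there are $\varepsilon>0$ and an open ball $B\subset U$ of positive radius centred at $y$ such that $u-\varepsilon\|\cdot\|^2$ is $q$-plurisubharmonic on $B$. * For $X\subset\mathbb{C}^n$, $u:X\to[-\infty,\infty)$ and $\Phi:\mathbb{C}^n\to[-\infty,\infty)$,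 the sup-convolution is $u_X^\Phi(y)=\sup_{x\in X}\{u(x)+\Phi(y-x)\}\in[-\infty,\infty]$ for $y\in\mathbb{C}^n$. Its proper set of definition is the set of all $y\in\mathbb{C}^n$ for which there is $\hat{x}\in X$ with $u_X^\Phi(y)=u(\hat{x})+\Phi(y-\hat{x})$. * $\Phi:\mathbb{C}^n\to\mathbb{R}$ is semiconvex with constant $\delta>0$ if $\Phi+\delta\|\cdot\|^2$ is convex on $\mathbb{C}^n$. Corollary. Let $u:U\to[-\infty,\infty)$ be strictly $q$-plurisubharmonic on a non-empty open set $U\subset\mathbb{C}^n$, let $\Omega$ be an open set whose closure is compact and contained in $U$, and let $\Phi:\mathbb{C}^n\to\mathbb{R}$ be continuous and semiconvex with some constant $\delta>0$. Suppose that the proper set of definition of the sup-convolution $[u|_\Omega]_\Omega^\Phi$ has non-empty interior $W$. Then the restriction of $[u|_\Omega]_\Omega^\Phi$ to $W$ is continuous (as a function with values in $[-\infty,\infty)$) and strictly $q$-plurisubharmonic on $W$. -/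

import Mathlib

open Set

noncomputable section

/-- A real-valued function `h` is plurisubharmonic and continuous on the open set `V`: `h` is
continuous on `V` and satisfies the sub-mean value inequality on every closed complex disc
`{a + ζ b : |ζ| ≤ 1}` contained in `V`. -/
def IsContinuousPsh {n : ℕ} (h : EuclideanSpace ℂ (Fin n) → ℝ)
    (V : Set (EuclideanSpace ℂ (Fin n))) : Prop :=
  ContinuousOn h V ∧
    ∀ a b : EuclideanSpace ℂ (Fin n), (∀ ζ : ℂ, ‖ζ‖ ≤ 1 → a + ζ • b ∈ V) →
      h a ≤ Real.circleAverage (fun ζ : ℂ => h (a + ζ • b)) 0 1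

/-- An upper semicontinuous function `u : U → [-∞, ∞)` is subpluriharmonic on the open set `U`:
either `u ≡ -∞` on `U`, or, for every compact ball contained in `U` and every continuous
plurisubharmonic `h` on a neighbourhood `V` of that ball, the maximum of `u + h` over the ball is
attained at a boundary point. Only the values of `u` on `U` matter. -/
def IsSubpluriharmonicOn {n : ℕ} (u : EuclideanSpace ℂ (Fin n) → EReal)
    (U : Set (EuclideanSpace ℂ (Fin n))) : Prop :=
  (∀ x ∈ U, u x < ⊤) ∧ UpperSemicontinuousOn u U ∧
    ((∀ x ∈ U, u x = ⊥) ∨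
      ∀ (c : EuclideanSpace ℂ (Fin n)) (r : ℝ), 0 < r → Metric.closedBall c r ⊆ U →
        ∀ (V : Set (EuclideanSpace ℂ (Fin n))) (h : EuclideanSpace ℂ (Fin n) → ℝ),
          IsOpen V → Metric.closedBall c r ⊆ V → IsContinuousPsh h V →
            ∃ b ∈ Metric.sphere c r, ∀ x ∈ Metric.closedBall c r,
              u x + (h x : EReal) ≤ u b + (h b : EReal))

/-- `u : U → [-∞, ∞)` is `q`-plurisubharmonic on the open set `U ⊆ ℂⁿ`: it is upper semicontinuous
and, if `q < n`, it is subpluriharmonic on `U ∩ π` for every complex affine subspace `π` of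
dimension `q + 1`. The subspaces `π` are parametrised by the complex affine isometric embeddings
`z ↦ a + L z` of `ℂ^(q+1)` into `ℂⁿ`. If `q ≥ n`, every upper semicontinuous function
qualifies. -/
def IsQPshOn {n : ℕ} (q : ℕ) (u : EuclideanSpace ℂ (Fin n) → EReal)
    (U : Set (EuclideanSpace ℂ (Fin n))) : Prop :=
  (∀ x ∈ U, u x < ⊤) ∧ UpperSemicontinuousOn u U ∧
    (q < n →
      ∀ (a : EuclideanSpace ℂ (Fin n))
        (L : EuclideanSpace ℂ (Fin (q + 1)) →ₗᵢ[ℂ] EuclideanSpace ℂ (Fin n)),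
        IsSubpluriharmonicOn (fun z => u (a + L z)) {z | a + L z ∈ U})

/-- `u : U → [-∞, ∞)` is strictly `q`-plurisubharmonic on the open set `U`: it is upper
semicontinuous, and every point of `U` is the centre of an open ball `B ⊆ U` on which
`u - ε ‖·‖²` is `q`-plurisubharmonic for some `ε > 0`. -/
def IsStrictlyQPshOn {n : ℕ} (q : ℕ) (u : EuclideanSpace ℂ (Fin n) → EReal)
    (U : Set (EuclideanSpace ℂ (Fin n))) : Prop :=
  (∀ x ∈ U, u x < ⊤) ∧ UpperSemicontinuousOn u U ∧
    ∀ y ∈ U, ∃ ε : ℝ, 0 < ε ∧ ∃ r : ℝ, 0 < r ∧ Metric.ball y r ⊆ U ∧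
      IsQPshOn q (fun x => u x - ((ε * ‖x‖ ^ 2 : ℝ) : EReal)) (Metric.ball y r)

/-- The sup-convolution `y ↦ sup_{x ∈ X} (u x + Φ (y - x))`, with values in `[-∞, ∞]`. -/
def supConv {n : ℕ} (X : Set (EuclideanSpace ℂ (Fin n)))
    (u Φ : EuclideanSpace ℂ (Fin n) → EReal) (y : EuclideanSpace ℂ (Fin n)) : EReal :=
  ⨆ x ∈ X, (u x + Φ (y - x))

/-- The proper set of definition of the sup-convolution: the points at which the supremum is
attained. -/
def properSet {n : ℕ} (X : Set (EuclideanSpace ℂ (Fin n)))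
    (u Φ : EuclideanSpace ℂ (Fin n) → EReal) : Set (EuclideanSpace ℂ (Fin n)) :=
  {y | ∃ x ∈ X, supConv X u Φ y = u x + Φ (y - x)}

/-- A real-valued function `Φ` on `ℂⁿ` is semiconvex with constant `δ`: `Φ + δ ‖·‖²` is convex
on `ℂⁿ`. -/
def IsSemiconvexWith {n : ℕ} (δ : ℝ) (Φ : EuclideanSpace ℂ (Fin n) → ℝ) : Prop :=
  ConvexOn ℝ univ (fun x => Φ x + δ * ‖x‖ ^ 2)

end

/-! The function `S = supConv Ω u Φ` takes its value at `y₀ ∈ W` at some `x₀ ∈ Ω`. Translating by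
`y₀ - x₀`, the function `y ↦ u (y - y₀ + x₀) + Φ (y₀ - x₀)` lies below `S` near `y₀` and agrees
with it at `y₀`. Functions touched from below by subpluriharmonic ones need not inherit the
maximum property, because a maximum on a small ball may be attained in the interior as well as on
the boundary. Strictness removes this obstruction: if `u - ε ‖·‖²` is `q`-plurisubharmonic near
`x₀`, then for every continuous plurisubharmonic `h` on a slice, `u + h` exceeds its value at the
centre by at least `ε r²` somewhere on every small sphere of radius `r`
(`IsQPshOn.exists_quadratic_growth`).

Compactness of `closure Ω` provides one `ε' > 0` smaller than all the `ε` that occur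
(`IsStrictlyQPshOn.exists_uniform`). On a slice, an interior maximum of `S - ε' ‖·‖² + h` at `y₀`
would bound the growth of the touching function by `ε' r² < ε r²`, a contradiction. In both
steps, `‖p + L z‖² - ‖z‖²` is the real part of a complex affine function when `L` is a
complex linear isometry, so such terms may be absorbed into `h`.

Continuity of `S` follows from the uniform continuity of `Φ` on compact sets, which makes
`S` either finite and continuous on the whole space or identically `-∞`. -/

open Topology Filter

/-! ### Plurisubharmonic perturbations -/

/-- Subtracting the square of the norm along a complex isometric slice leaves a pluriharmonic
function, which may be added with a coefficient of either sign. -/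
theorem IsContinuousPsh.add_normSq_sub {n k : ℕ} {h : EuclideanSpace ℂ (Fin k) → ℝ}
    {V : Set (EuclideanSpace ℂ (Fin k))} (hh : IsContinuousPsh h V) (c : ℝ)
    (p : EuclideanSpace ℂ (Fin n)) (z₀ : EuclideanSpace ℂ (Fin k))
    (L : EuclideanSpace ℂ (Fin k) →ₗᵢ[ℂ] EuclideanSpace ℂ (Fin n)) :
    IsContinuousPsh (fun z => h z + c * (‖p + L (z - z₀)‖ ^ 2 - ‖z - z₀‖ ^ 2)) V := by
  have hL : Continuous L := L.continuous
  have hcont : Continuous (fun z => c * (‖p + L (z - z₀)‖ ^ 2 - ‖z - z₀‖ ^ 2)) := by fun_prop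
  refine ⟨hh.1.add hcont.continuousOn, fun a b hab => ?_⟩
  have hre : ∀ z, c * (‖p + L (z - z₀)‖ ^ 2 - ‖z - z₀‖ ^ 2) =
      c * (‖p‖ ^ 2 + 2 * (inner ℂ p (L (z - z₀))).re) := by
    intro z
    rw [@norm_add_sq ℂ, L.norm_map]
    simp only [RCLike.re_to_complex]
    ring
  have hline : Continuous (fun ζ : ℂ => a + ζ • b) := by fun_prop
  have hmem : ∀ ζ ∈ Metric.sphere (0 : ℂ) |1|, a + ζ • b ∈ V := by
    intro ζ hζ
    refine hab ζ ?_
    simpa using le_of_eq (mem_sphere_zero_iff_norm.1 hζ)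
  have hharm : InnerProductSpace.HarmonicOnNhd
      (fun ζ : ℂ => c * (‖p + L (a + ζ • b - z₀)‖ ^ 2 - ‖a + ζ • b - z₀‖ ^ 2))
      (Metric.closedBall 0 |1|) := by
    intro ζ _
    have hE : (fun ζ : ℂ => c * (‖p + L (a + ζ • b - z₀)‖ ^ 2 - ‖a + ζ • b - z₀‖ ^ 2)) =
        fun ζ : ℂ => ((c : ℂ) * ((‖p‖ ^ 2 : ℝ) +
          2 * (inner ℂ p (L (a - z₀)) + ζ * inner ℂ p (L b)))).re := by
      funext ζ
      rw [hre, show a + ζ • b - z₀ = (a - z₀) + ζ • b by abel, map_add, map_smul, inner_add_right,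
        inner_smul_right, Complex.re_ofReal_mul, Complex.add_re, Complex.add_re, Complex.ofReal_re,
        show (2 : ℂ) = ((2 : ℝ) : ℂ) by norm_num, Complex.re_ofReal_mul,
        Complex.add_re]
    rw [hE]
    exact AnalyticAt.harmonicAt_re (by fun_prop)
  have h1 : CircleIntegrable (fun ζ : ℂ => h (a + ζ • b)) 0 1 :=
    (hh.1.comp hline.continuousOn hmem).circleIntegrable'
  have h2 : CircleIntegrable
      (fun ζ : ℂ => c * (‖p + L (a + ζ • b - z₀)‖ ^ 2 - ‖a + ζ • b - z₀‖ ^ 2)) 0 1 :=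
    (hcont.comp hline).continuousOn.circleIntegrable'
  have h3 := hharm.circleAverage_eq
  have h4 := Real.circleAverage_add h1 h2
  have h5 := hh.2 a b hab
  rw [h3] at h4
  simp only [zero_smul, add_zero] at h4
  change _ ≤ Real.circleAverage ((fun ζ : ℂ => h (a + ζ • b)) +
    (fun ζ : ℂ => c * (‖p + L (a + ζ • b - z₀)‖ ^ 2 - ‖a + ζ • b - z₀‖ ^ 2))) 0 1
  rw [h4]
  linarith

/-! ### Strictly `q`-plurisubharmonic functions -/

/-- If `u - ε ‖·‖²` is `q`-plurisubharmonic, then on every complex slice of dimension `q + 1`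
and arbitrarily close to a given point, `u + h` exceeds its value at that point by `ε` times the
square of the distance. -/
theorem IsQPshOn.exists_quadratic_growth {n q : ℕ} (hq : q < n)
    {u : EuclideanSpace ℂ (Fin n) → EReal} {ε : ℝ} {B : Set (EuclideanSpace ℂ (Fin n))}
    (hB : IsOpen B)
    (hu : IsQPshOn q (fun x => u x - ((ε * ‖x‖ ^ 2 : ℝ) : EReal)) B)
    {x₀ : EuclideanSpace ℂ (Fin n)} (hx₀ : x₀ ∈ B) {m : ℝ} (hm : u x₀ = m)
    (z₀ : EuclideanSpace ℂ (Fin (q + 1)))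
    (L : EuclideanSpace ℂ (Fin (q + 1)) →ₗᵢ[ℂ] EuclideanSpace ℂ (Fin n))
    {V : Set (EuclideanSpace ℂ (Fin (q + 1)))} (hV : IsOpen V)
    {h : EuclideanSpace ℂ (Fin (q + 1)) → ℝ} (hh : IsContinuousPsh h V)
    {N : Set (EuclideanSpace ℂ (Fin (q + 1)))} (hN : N ∈ 𝓝 z₀) (hNV : N ⊆ V) :
    ∃ b ∈ N, b ≠ z₀ ∧ ∃ t : ℝ, u (x₀ + L (b - z₀)) = t ∧
      m + h z₀ + ε * ‖b - z₀‖ ^ 2 ≤ t + h b := by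
  have hL : Continuous L := L.continuous
  have hxz : ∀ z, (x₀ - L z₀) + L z = x₀ + L (z - z₀) := fun z => by rw [map_sub]; abel
  have hpre : {z | (x₀ - L z₀) + L z ∈ B} ∈ 𝓝 z₀ := by
    have hc : Continuous fun z => (x₀ - L z₀) + L z := by fun_prop
    refine hc.continuousAt.preimage_mem_nhds (hB.mem_nhds ?_)
    simpa using hx₀
  obtain ⟨r, hr, hrs⟩ := Metric.nhds_basis_closedBall.mem_iff.1 (inter_mem hpre hN)
  have hz₀ : z₀ ∈ Metric.closedBall z₀ r := Metric.mem_closedBall_self hr.le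
  obtain ⟨-, -, hbot | hmax⟩ := hu.2.2 hq (x₀ - L z₀) L
  · have := hbot z₀ (hrs hz₀).1
    simp only [sub_add_cancel, hm] at this
    exact absurd this (by exact_mod_cast EReal.coe_ne_bot _)
  · obtain ⟨b, hb, hb'⟩ := hmax z₀ r hr (fun z hz => (hrs hz).1) V _ hV
      (fun z hz => hNV (hrs hz).2) (hh.add_normSq_sub ε x₀ z₀ L)
    have hbr : b ∈ Metric.closedBall z₀ r := Metric.sphere_subset_closedBall hb
    have hlt := hu.1 _ (hrs hbr).1
    have hmain := hb' z₀ hz₀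
    simp only [hxz] at hlt hmain
    simp only [sub_self, map_zero, add_zero, hm, norm_zero, zero_pow two_ne_zero,
      sub_zero] at hmain
    refine ⟨b, (hrs hbr).2, ?_, ?_⟩
    · rintro rfl
      simp [hr.ne] at hb
    · induction hub : u (x₀ + L (b - z₀)) with
      | bot =>
        rw [hub, EReal.bot_sub, EReal.bot_add] at hmain
        exact absurd (le_bot_iff.1 hmain) (by exact_mod_cast EReal.coe_ne_bot _)
      | top =>
        rw [hub, EReal.top_sub_coe] at hlt
        exact absurd hlt (lt_irrefl _)
      | coe t =>
        refine ⟨t, rfl, ?_⟩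
        rw [hub] at hmain
        norm_cast at hmain
        linarith

/-- On a compact set, the constants measuring strict `q`-plurisubharmonicity are bounded away
from zero. -/
theorem IsStrictlyQPshOn.exists_uniform {n q : ℕ} {u : EuclideanSpace ℂ (Fin n) → EReal}
    {U K : Set (EuclideanSpace ℂ (Fin n))} (hu : IsStrictlyQPshOn q u U) (hK : IsCompact K)
    (hKU : K ⊆ U) :
    ∃ ε' : ℝ, 0 < ε' ∧ ∀ x ∈ K, ∃ ε > ε', ∃ B, IsOpen B ∧ x ∈ B ∧
      IsQPshOn q (fun x => u x - ((ε * ‖x‖ ^ 2 : ℝ) : EReal)) B := by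
  refine hK.induction_on (p := fun s => ∃ ε' : ℝ, 0 < ε' ∧ ∀ x ∈ s, ∃ ε > ε', ∃ B, IsOpen B ∧
      x ∈ B ∧ IsQPshOn q (fun x => u x - ((ε * ‖x‖ ^ 2 : ℝ) : EReal)) B) ?_ ?_ ?_ ?_
  · exact ⟨1, one_pos, by simp⟩
  · rintro s t hst ⟨ε', h0, h⟩
    exact ⟨ε', h0, fun x hx => h x (hst hx)⟩
  · rintro s t ⟨ε₁, h₁, hs⟩ ⟨ε₂, h₂, ht⟩
    refine ⟨min ε₁ ε₂, lt_min h₁ h₂, ?_⟩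
    rintro x (hx | hx)
    · obtain ⟨ε, hε, h⟩ := hs x hx
      exact ⟨ε, (min_le_left _ _).trans_lt hε, h⟩
    · obtain ⟨ε, hε, h⟩ := ht x hx
      exact ⟨ε, (min_le_right _ _).trans_lt hε, h⟩
  · intro x hx
    obtain ⟨ε, hε, r, hr, -, hq⟩ := hu.2.2 x (hKU hx)
    exact ⟨Metric.ball x r, mem_nhdsWithin_of_mem_nhds (Metric.ball_mem_nhds x hr), ε / 2,
      half_pos hε, fun y hy => ⟨ε, half_lt_self hε, _, Metric.isOpen_ball, hy, hq⟩⟩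

/-! ### Finiteness and continuity of the sup-convolution -/

theorem supConv_eq_bot {n : ℕ} {X : Set (EuclideanSpace ℂ (Fin n))}
    {u Φ : EuclideanSpace ℂ (Fin n) → EReal} (hu : ∀ x ∈ X, u x = ⊥)
    (y : EuclideanSpace ℂ (Fin n)) : supConv X u Φ y = ⊥ := by
  simp only [supConv, iSup_eq_bot]
  intro x hx
  rw [hu x hx, EReal.bot_add]

/-- If `u` is upper semicontinuous on the compact set `closure X` and not identically `-∞` on `X`,
then the sup-convolution with a continuous real function is finite and continuous. -/
theorem exists_continuous_supConv_eq {n : ℕ} {X : Set (EuclideanSpace ℂ (Fin n))}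
    (hX : IsCompact (closure X)) {u : EuclideanSpace ℂ (Fin n) → EReal}
    (hlt : ∀ x ∈ closure X, u x < ⊤) (hu : UpperSemicontinuousOn u (closure X))
    {Φ : EuclideanSpace ℂ (Fin n) → ℝ} (hΦ : Continuous Φ) (hbot : ∃ x ∈ X, u x ≠ ⊥) :
    ∃ s : EuclideanSpace ℂ (Fin n) → ℝ, Continuous s ∧
      ∀ y, supConv X u (fun x => (Φ x : EReal)) y = s y := by
  obtain ⟨x₁, hx₁, hne⟩ := hbot
  obtain ⟨x₂, hx₂, hmax⟩ := hu.exists_isMaxOn ⟨x₁, subset_closure hx₁⟩ hX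
  have hfin : ∀ y, ∃ t : ℝ, supConv X u (fun x => (Φ x : EReal)) y = t := by
    intro y
    have hc : Continuous fun x => Φ (y - x) := by fun_prop
    obtain ⟨x₃, -, hmax₃⟩ := hX.exists_isMaxOn ⟨x₁, subset_closure hx₁⟩ hc.continuousOn
    have hup : supConv X u (fun x => (Φ x : EReal)) y ≤ u x₂ + (Φ (y - x₃) : EReal) :=
      iSup₂_le fun x hx => add_le_add (hmax (subset_closure hx))
        (EReal.coe_le_coe_iff.2 (hmax₃ (subset_closure hx)))
    have hlow : u x₁ + (Φ (y - x₁) : EReal) ≤ supConv X u (fun x => (Φ x : EReal)) y :=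
      le_iSup₂ (f := fun x _ => u x + (Φ (y - x) : EReal)) x₁ hx₁
    refine ⟨(supConv X u (fun x => (Φ x : EReal)) y).toReal, (EReal.coe_toReal ?_ ?_).symm⟩
    · exact (hup.trans_lt (EReal.add_lt_top (hlt x₂ hx₂).ne (EReal.coe_ne_top _))).ne
    · intro h
      rw [h, le_bot_iff, EReal.add_eq_bot_iff] at hlow
      exact hlow.elim hne (EReal.coe_ne_bot _)
  choose s hs using hfin
  refine ⟨s, ?_, hs⟩
  have hstep : ∀ y y' : EuclideanSpace ℂ (Fin n), ∀ η : ℝ,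
      (∀ x ∈ closure X, Φ (y - x) ≤ Φ (y' - x) + η) → s y ≤ s y' + η := by
    intro y y' η hη
    rw [← EReal.coe_le_coe_iff, EReal.coe_add, ← hs, ← hs]
    refine iSup₂_le fun x hx => ?_
    calc u x + (Φ (y - x) : EReal) ≤ u x + ((Φ (y' - x) + η : ℝ) : EReal) :=
          add_le_add le_rfl (EReal.coe_le_coe_iff.2 (hη x (subset_closure hx)))
      _ = (u x + (Φ (y' - x) : EReal)) + η := by rw [EReal.coe_add, add_assoc]
      _ ≤ _ := add_le_add (le_iSup₂ (f := fun x _ => u x + (Φ (y' - x) : EReal)) x hx) le_rfl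
  rw [continuous_iff_continuousAt]
  intro y₀
  rw [Metric.continuousAt_iff']
  intro η hη
  have hc : Continuous (Function.uncurry fun y x => Φ (y - x)) := by
    simp only [Function.uncurry_def]
    fun_prop
  obtain ⟨v, hv, hv'⟩ := hX.mem_uniformity_of_prod (s := univ) hc.continuousOn (mem_univ y₀)
    (Metric.dist_mem_uniformity (half_pos hη))
  rw [nhdsWithin_univ] at hv
  filter_upwards [hv] with y hy
  have h1 := hstep y y₀ (η / 2) fun x hx => by
    have := hv' y hy x hx
    rw [mem_ofPred_eq, Real.dist_eq, abs_lt] at this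
    linarith
  have h2 := hstep y₀ y (η / 2) fun x hx => by
    have := hv' y hy x hx
    rw [mem_ofPred_eq, Real.dist_eq, abs_lt] at this
    linarith
  rw [Real.dist_eq, abs_lt]
  constructor <;> linarith

/-! ### The sup-convolution is strictly `q`-plurisubharmonic -/

theorem isSubpluriharmonicOn_of_eq_bot {n : ℕ} {u : EuclideanSpace ℂ (Fin n) → EReal}
    {U : Set (EuclideanSpace ℂ (Fin n))} (h : ∀ x ∈ U, u x = ⊥) : IsSubpluriharmonicOn u U := by
  refine ⟨fun x hx => ?_, fun x hx => ?_, Or.inl h⟩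
  · rw [h x hx]
    exact bot_lt_top
  · intro t ht
    filter_upwards [self_mem_nhdsWithin] with z hz
    rw [h z hz]
    rwa [h x hx] at ht

theorem IsQPshOn.of_eq_bot {n q : ℕ} {u : EuclideanSpace ℂ (Fin n) → EReal}
    {U : Set (EuclideanSpace ℂ (Fin n))} (h : ∀ x ∈ U, u x = ⊥) : IsQPshOn q u U :=
  ⟨(isSubpluriharmonicOn_of_eq_bot h).1, (isSubpluriharmonicOn_of_eq_bot h).2.1,
    fun _ _ _ => isSubpluriharmonicOn_of_eq_bot fun _ hz => h _ hz⟩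

/-- Maximum property of `S - ε' ‖·‖²` on slices, where `S` is a finite sup-convolution attained
on the set under consideration: by quadratic growth of the touching translate of `u`, there are no
maxima in the interior of a ball. -/
theorem isQPshOn_supConv_sub {n q : ℕ} {X B : Set (EuclideanSpace ℂ (Fin n))} (hX : IsOpen X)
    {u : EuclideanSpace ℂ (Fin n) → EReal} {ε' : ℝ}
    (hu : ∀ x ∈ X, ∃ ε > ε', ∃ D, IsOpen D ∧ x ∈ D ∧
      IsQPshOn q (fun x => u x - ((ε * ‖x‖ ^ 2 : ℝ) : EReal)) D)
    {Φ s : EuclideanSpace ℂ (Fin n) → ℝ} (hs : Continuous s)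
    (hsS : ∀ y, supConv X u (fun x => (Φ x : EReal)) y = s y)
    (hB : B ⊆ properSet X u (fun x => (Φ x : EReal))) :
    IsQPshOn q (fun x => supConv X u (fun x => (Φ x : EReal)) x -
      ((ε' * ‖x‖ ^ 2 : ℝ) : EReal)) B := by
  have hsub : (fun x => supConv X u (fun x => (Φ x : EReal)) x - ((ε' * ‖x‖ ^ 2 : ℝ) : EReal)) =
      fun x => ((s x - ε' * ‖x‖ ^ 2 : ℝ) : EReal) := by
    funext x
    rw [hsS, EReal.coe_sub]
  rw [hsub]
  have hcont : Continuous fun x => ((s x - ε' * ‖x‖ ^ 2 : ℝ) : EReal) :=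
    continuous_coe_real_ereal.comp (by fun_prop)
  refine ⟨fun _ _ => EReal.coe_lt_top _, hcont.upperSemicontinuous.upperSemicontinuousOn _,
    fun hq a L => ⟨fun _ _ => EReal.coe_lt_top _, ?_, Or.inr ?_⟩⟩
  · have hL : Continuous L := L.continuous
    exact (hcont.comp (continuous_const.add hL)).upperSemicontinuous.upperSemicontinuousOn _
  intro c r hr hcB V h hV hcV hh
  have hL : Continuous L := L.continuous
  have hcts : ContinuousOn (fun z => s (a + L z) - ε' * ‖a + L z‖ ^ 2 + h z)
      (Metric.closedBall c r) :=
    Continuous.continuousOn (by fun_prop) |>.add (hh.1.mono hcV)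
  obtain ⟨z₀, hz₀, hmax⟩ := (isCompact_closedBall c r).exists_isMaxOn
    (Metric.nonempty_closedBall.2 hr.le) hcts
  refine ⟨z₀, ?_, fun z hz => ?_⟩
  swap
  · have := hmax hz
    rw [← EReal.coe_add, ← EReal.coe_add]
    exact EReal.coe_le_coe_iff.2 this
  by_contra hns
  have hz₀b : z₀ ∈ Metric.ball c r :=
    lt_of_le_of_ne hz₀ hns
  obtain ⟨x₀, hx₀, hatt⟩ := hB (hcB hz₀)
  obtain ⟨ε, hε, D, hD, hxD, hqD⟩ := hu x₀ hx₀
  rw [hsS] at hatt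
  obtain ⟨m, hm⟩ : ∃ m : ℝ, u x₀ = m := by
    induction hux : u x₀ with
    | bot =>
      rw [hux, EReal.bot_add] at hatt
      exact absurd hatt (EReal.coe_ne_bot _)
    | top =>
      rw [hux, EReal.top_add_coe] at hatt
      exact absurd hatt (EReal.coe_ne_top _)
    | coe m => exact ⟨m, rfl⟩
  rw [hm] at hatt
  beta_reduce at hatt
  norm_cast at hatt
  have hyz : ∀ z, a + L z = (a + L z₀) + L (z - z₀) := fun z => by rw [map_sub]; abel
  -- The translate of `u` competes in the supremum only as long as its argument stays in `X`.
  have hN : Metric.ball c r ∩ {z | x₀ + L (z - z₀) ∈ X} ∈ 𝓝 z₀ := by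
    refine inter_mem (Metric.isOpen_ball.mem_nhds hz₀b) ?_
    have hc : Continuous fun z => x₀ + L (z - z₀) := by fun_prop
    exact hc.continuousAt.preimage_mem_nhds (hX.mem_nhds (by simpa using hx₀))
  obtain ⟨b, hb, hbne, t, ht, hgrow⟩ := hqD.exists_quadratic_growth hq hD hxD hm z₀ L hV
    (hh.add_normSq_sub (-ε') (a + L z₀) z₀ L) hN
    fun z hz => hcV (Metric.ball_subset_closedBall hz.1)
  have hmaxb := hmax (Metric.ball_subset_closedBall hb.1)
  have htouch : t + Φ (a + L z₀ - x₀) ≤ s (a + L b) := by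
    have := le_iSup₂ (f := fun x _ => u x + (Φ (a + L b - x) : EReal)) (x₀ + L (b - z₀)) hb.2
    change _ ≤ supConv X u (fun x => (Φ x : EReal)) (a + L b) at this
    rw [hsS, ht, show a + L b - (x₀ + L (b - z₀)) = a + L z₀ - x₀ by rw [map_sub]; abel] at this
    exact_mod_cast this
  have hpos : 0 < ‖b - z₀‖ ^ 2 := by
    have := norm_pos_iff.2 (sub_ne_zero.2 hbne)
    positivity
  simp only [mem_ofPred_eq] at hmaxb
  rw [hyz b] at hmaxb htouch
  simp only [sub_self, map_zero, add_zero, norm_zero] at hgrow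
  -- Together, growth, maximality and touching give `ε ‖b - z₀‖² ≤ ε' ‖b - z₀‖²`.
  nlinarith [mul_pos (sub_pos.2 hε) hpos]

theorem mainTheorem4 (n q : ℕ) (U : Set (EuclideanSpace ℂ (Fin n))) (hU : IsOpen U)
    (hUne : U.Nonempty)
    (u : EuclideanSpace ℂ (Fin n) → EReal) (hu : IsStrictlyQPshOn q u U)
    (Ω : Set (EuclideanSpace ℂ (Fin n))) (hΩ : IsOpen Ω)
    (hΩc : IsCompact (closure Ω)) (hΩU : closure Ω ⊆ U)
    (Φ : EuclideanSpace ℂ (Fin n) → ℝ) (hΦ : Continuous Φ)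
    (δ : ℝ) (hδ : 0 < δ) (hΦδ : IsSemiconvexWith δ Φ)
    (W : Set (EuclideanSpace ℂ (Fin n)))
    (hW : W = interior (properSet Ω u (fun x => (Φ x : EReal))))
    (hWne : W.Nonempty) :
    ContinuousOn (supConv Ω u (fun x => (Φ x : EReal))) W ∧
      IsStrictlyQPshOn q (supConv Ω u (fun x => (Φ x : EReal))) W := by
  have hWp : W ⊆ properSet Ω u (fun x => (Φ x : EReal)) := hW ▸ interior_subset
  have hWo : IsOpen W := hW ▸ isOpen_interior
  by_cases hbot : ∀ x ∈ Ω, u x = ⊥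
  · have hS : supConv Ω u (fun x => (Φ x : EReal)) = fun _ => ⊥ := funext (supConv_eq_bot hbot)
    rw [hS]
    refine ⟨continuousOn_const, fun _ _ => bot_lt_top,
      continuousOn_const.upperSemicontinuousOn, fun y hy => ?_⟩
    obtain ⟨r, hr, hrW⟩ := Metric.isOpen_iff.1 hWo y hy
    exact ⟨1, one_pos, r, hr, hrW, IsQPshOn.of_eq_bot fun _ _ => EReal.bot_sub _⟩
  · push Not at hbot
    obtain ⟨s, hs, hsS⟩ := exists_continuous_supConv_eq hΩc (fun x hx => hu.1 x (hΩU hx))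
      (hu.2.1.mono hΩU) hΦ hbot
    obtain ⟨ε, hε, hunif⟩ := hu.exists_uniform hΩc hΩU
    have hcont : Continuous (supConv Ω u (fun x => (Φ x : EReal))) := by
      rw [funext hsS]
      exact continuous_coe_real_ereal.comp hs
    refine ⟨hcont.continuousOn, fun y _ => ?_, hcont.upperSemicontinuous.upperSemicontinuousOn _,
      fun y hy => ?_⟩
    · rw [hsS]
      exact EReal.coe_lt_top _
    · obtain ⟨r, hr, hrW⟩ := Metric.isOpen_iff.1 hWo y hy
      exact ⟨ε, hε, r, hr, hrW, isQPshOn_supConv_sub hΩ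
        (fun x hx => hunif x (subset_closure hx)) hs hsS (hrW.trans hWp)⟩
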